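/- Let $H$ be a torsion-free hyperbolic group, that is, a group in which only $1$ has finite order and which has a finite generating set whose word metric is Gromov-hyperbolic. Equip $H$, as a discrete group, with a proper left-invariant metric $d$ (for example, a word metric with respect to a finite generating set). Let $G$ be an arbitrary group. A map $f\colon G\to H$ is called a quasihomomorphism if there is a constant $C$ such that $d(f(xy),f(x)f(y))\le C$ for all $x,y\in G$; it is called bounded if its image is a bounded (equivalently, finite) subset of $H$. Let $f_1,f_2\colon G\to H$ be quasihomomorphisms with $\operatorname{dist}(f_1,f_2):=\sup_{x\in G}d(f_1(x),f_2(x))<\infty$. Then at least one of the following holds: (a) both $f_1$ and $f_2$ are bounded; (b) both $f_1$ and $f_2$ take values in the same cyclic subgroup of $H$; (c) $f_1=f_2$. -/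

import Mathlib

/-- The word metric on a group `H` with respect to a generating set `S`: the path metric on the
vertices of the Cayley graph, whose edges join `g` to `g * s` for `s ∈ S`. -/
noncomputable def wordDist {H : Type*} [Group H] (S : Set H) (g h : H) : ℝ :=
  ((SimpleGraph.mulCayley S).dist g h : ℝ)

/-- The Gromov product `(x | y)_w` with respect to the distance function `d`. -/
noncomputable def gromovProduct {X : Type*} (d : X → X → ℝ) (w x y : X) : ℝ :=
  (d w x + d w y - d x y) / 2

/-- `d` is Gromov-hyperbolic: for some `δ`, every four points satisfy
`(x | z)_w ≥ min ((x | y)_w) ((y | z)_w) - δ`. -/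
def IsGromovHyperbolic {X : Type*} (d : X → X → ℝ) : Prop :=
  ∃ δ : ℝ, ∀ w x y z : X,
    min (gromovProduct d w x y) (gromovProduct d w y z) - δ ≤ gromovProduct d w x z

/-- A hyperbolic group: it has a finite generating set whose word metric is Gromov-hyperbolic. -/
def IsHyperbolicGroup (H : Type*) [Group H] : Prop :=
  ∃ S : Finset H, Subgroup.closure (S : Set H) = ⊤ ∧ IsGromovHyperbolic (wordDist (S : Set H))

/-- A quasihomomorphism from a group `G` to a group `H` carrying a metric. -/
def IsQuasihomomorphism {G H : Type*} [Group G] [Group H] [MetricSpace H] (f : G → H) : Prop :=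
  ∃ C : ℝ, ∀ x y : G, dist (f (x * y)) (f x * f y) ≤ C

/-- `dist (f₁, f₂) = sup_x d (f₁ x, f₂ x)`, with values in `[0, ∞]`. -/
noncomputable def supDist {X Y : Type*} [MetricSpace Y] (f₁ f₂ : X → Y) : ENNReal :=
  ⨆ x : X, edist (f₁ x) (f₂ x)

/-!
If `f₁ ≠ f₂`, choose `x` with `b = (f₂ x)⁻¹ * f₁ x ≠ 1`. Expanding `f₁ (x * y)` both through `f₁`
and through `f₂`, which agree up to a finite set, shows that the conjugates `(f₂ y)⁻¹ * b * f₂ y`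
stay in a finite set as `y` varies, and the same then holds for `f₁`. If `f = f₁` or `f = f₂` is
unbounded, a pigeonhole argument finds `y`, `y'` such that `z = f y * (f y')⁻¹ ≠ 1` and
`f x * z * (f x)⁻¹` both commute with `b`, for any given `x`
(`finite_range_or_range_subset_centralizer`). So everything follows from two facts about a
torsion-free hyperbolic group: centralizers of nontrivial elements are cyclic
(`IsHyperbolicLength.isCyclic_centralizer`), and only elements of such a centralizer can
conjugate one of its nontrivial elements into it
(`IsHyperbolicLength.mem_centralizer_of_conj_mem`).

Both facts are derived from the four-point inequality for the word length `ℓ` alone.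

* If `ℓ (u ^ 2)` exceeds `ℓ u` by more than `δ`, then `ℓ (u ^ n)` is strictly increasing in `n`
  (`IsHyperbolicLength.length_pow_succ`).
* Every element `g` of infinite order has a power conjugate to such a `u`
  (`IsHyperbolicLength.exists_conj_pow_growing`). Otherwise choose, for given `N`, a base point
  minimising the largest displacement of `g, …, g ^ N`. If this displacement is large, moving the
  base point a little towards its farthest image reduces it; hence it is bounded independently of
  `N`, and `N + 1` distinct elements lie in a ball of fixed radius.
* A shortest representative `w` of a coset of `⟨u⟩` in the centralizer of `u` has bounded length, by
  comparing the sides and diagonals of the parallelogram `1, u ^ n, w * u ^ n, w`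
  (`IsHyperbolicLength.exists_length_mul_zpow_le`). So `⟨u⟩` has finite index in its centralizer,
  and the transfer embeds the centralizer into `⟨u⟩`.
* Growth of `ℓ (u ^ n)` excludes `h * c ^ k * h⁻¹ = c ^ l` with `|k| ≠ |l|`; the case `l = -k ≠ 0`
  is excluded because `h` commutes with `h ^ 2`, which commutes with `c ^ k`.
-/

/-! ### Word length in a hyperbolic group -/

/-- `ℓ` is the length function of a proper, geodesic, left-invariant, integer-valued metric
`(x, y) ↦ ℓ (x⁻¹ * y)` on `H` that is hyperbolic. The last field is the four-point condition
without Gromov products: `δ` is twice the usual constant. -/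
structure IsHyperbolicLength {H : Type*} [Group H] (ℓ : H → ℕ) (δ : ℕ) : Prop where
  one : ℓ 1 = 0
  eq_one : ∀ x, ℓ x = 0 → x = 1
  inv : ∀ x, ℓ x⁻¹ = ℓ x
  mul_le : ∀ x y, ℓ (x * y) ≤ ℓ x + ℓ y
  finite_ball : ∀ n, {x | ℓ x ≤ n}.Finite
  geodesic : ∀ q t, t ≤ ℓ q → ∃ p, ℓ p = t ∧ ℓ (p⁻¹ * q) = ℓ q - t
  fourPoint : ∀ w x y z, ℓ (w⁻¹ * y) + ℓ (x⁻¹ * z) ≤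
    max (ℓ (x⁻¹ * y) + ℓ (w⁻¹ * z)) (ℓ (y⁻¹ * z) + ℓ (w⁻¹ * x)) + δ

section WordLength

variable {H : Type*} [Group H] {S : Set H}

theorem mulCayley_dist_mul_left (a x y : H) :
    (SimpleGraph.mulCayley S).dist (a * x) (a * y) = (SimpleGraph.mulCayley S).dist x y := by
  have key : ∀ a x y : H, (SimpleGraph.mulCayley S).edist (a * x) (a * y) ≤
      (SimpleGraph.mulCayley S).edist x y := by
    intro a x y
    by_cases h : (SimpleGraph.mulCayley S).edist x y = ⊤
    · rw [h]; exact le_top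
    · obtain ⟨p, hp⟩ := SimpleGraph.exists_walk_of_edist_ne_top h
      rw [← hp]
      let φ : SimpleGraph.mulCayley S →g SimpleGraph.mulCayley S :=
        ⟨fun z => a * z, fun h => SimpleGraph.mulCayley_adj_mul_iff_right.2 h⟩
      have := SimpleGraph.edist_le (p.map φ)
      rwa [SimpleGraph.Walk.length_map] at this
  unfold SimpleGraph.dist
  congr 1
  refine le_antisymm (key a x y) ?_
  simpa using key a⁻¹ (a * x) (a * y)

theorem mulCayley_connected (hS : Subgroup.closure S = ⊤) :
    (SimpleGraph.mulCayley S).Connected := by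
  have reach : ∀ g x : H, (SimpleGraph.mulCayley S).Reachable x (x * g) := by
    intro g
    have hg : g ∈ Subgroup.closure S := hS ▸ Subgroup.mem_top g
    induction hg using Subgroup.closure_induction with
    | mem s hs =>
      intro x
      by_cases h : x = x * s
      · rw [← h]
      · exact SimpleGraph.Adj.reachable
          ((SimpleGraph.mulCayley_adj' S x (x * s)).2 ⟨h, s, hs, Or.inl rfl⟩)
    | one => intro x; simp
    | mul a b _ _ iha ihb => intro x; rw [← mul_assoc]; exact (iha x).trans (ihb _)
    | inv a _ iha => intro x; simpa using (iha (x * a⁻¹)).symm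
  have : Nonempty H := ⟨1⟩
  refine SimpleGraph.Connected.mk fun x y => ?_
  simpa using reach (x⁻¹ * y) x

theorem mulCayley_finite_ball (hS : S.Finite) (hc : (SimpleGraph.mulCayley S).Connected) (n : ℕ) :
    {x | (SimpleGraph.mulCayley S).dist 1 x ≤ n}.Finite := by
  induction n with
  | zero =>
    refine (Set.finite_singleton (1 : H)).subset fun x hx => ?_
    have : (SimpleGraph.mulCayley S).dist 1 x = 0 := Nat.le_zero.1 hx
    exact ((hc.dist_eq_zero_iff).1 this).symm
  | succ n ih =>
    refine (ih.union ((Set.Finite.image2 (fun x s => x * s) ih hS).union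
      (Set.Finite.image2 (fun x s => x * s⁻¹) ih hS))).subset fun x hx => ?_
    obtain ⟨p, hp⟩ := hc.exists_walk_length_eq_dist 1 x
    change (SimpleGraph.mulCayley S).dist 1 x ≤ n + 1 at hx
    by_cases h : (SimpleGraph.mulCayley S).dist 1 x ≤ n
    · exact Or.inl h
    · have hn : p.length = n + 1 := by omega
      have hadj := p.adj_getVert_succ (i := n) (by omega)
      rw [← hn, p.getVert_length] at hadj
      have hd : (SimpleGraph.mulCayley S).dist 1 (p.getVert n) ≤ n := by
        refine (SimpleGraph.dist_le (p.take n)).trans ?_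
        simp
      right
      obtain ⟨-, s, hs, h1 | h1⟩ := (SimpleGraph.mulCayley_adj' S _ _).1 hadj
      · exact Or.inl ⟨_, hd, s, hs, h1⟩
      · exact Or.inr ⟨_, hd, s, hs, by simp [h1]⟩

theorem IsHyperbolicGroup.exists_isHyperbolicLength (hH : IsHyperbolicGroup H) :
    ∃ (ℓ : H → ℕ) (δ : ℕ), IsHyperbolicLength ℓ δ := by
  obtain ⟨S, hS, δ, hδ⟩ := hH
  have hc := mulCayley_connected hS
  set Γ := SimpleGraph.mulCayley (S : Set H) with hΓ
  have hinv : ∀ x y : H, Γ.dist 1 (x⁻¹ * y) = Γ.dist x y := fun x y => by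
    simpa using (mulCayley_dist_mul_left (S := (S : Set H)) x 1 (x⁻¹ * y)).symm
  refine ⟨fun x => Γ.dist 1 x, ⌈2 * δ⌉₊, ?_, ?_, ?_, ?_, ?_, ?_, ?_⟩
  · simp
  · exact fun x hx => ((hc.dist_eq_zero_iff).1 hx).symm
  · intro x
    have := hinv x 1
    rw [mul_one] at this
    rw [this, SimpleGraph.dist_comm]
  · intro x y
    have h := hc.dist_triangle (u := 1) (v := x) (w := x * y)
    rwa [← hinv x (x * y), inv_mul_cancel_left] at h
  · exact fun n => mulCayley_finite_ball S.finite_toSet hc n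
  · intro q t ht
    obtain ⟨p, hp⟩ := hc.exists_walk_length_eq_dist 1 q
    refine ⟨p.getVert t, ?_⟩
    rw [hinv]
    have h1 : Γ.dist 1 (p.getVert t) ≤ t :=
      (SimpleGraph.dist_le (p.take t)).trans (by simp)
    have h2 : Γ.dist (p.getVert t) q ≤ p.length - t :=
      (SimpleGraph.dist_le (p.drop t)).trans (by simp)
    have h3 := hc.dist_triangle (u := 1) (v := p.getVert t) (w := q)
    omega
  · intro w x y z
    simp only [hinv]
    have h := hδ w x y z
    have hceil := Nat.le_ceil (2 * δ)
    simp only [gromovProduct, wordDist, ← hΓ] at h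
    have hr : (Γ.dist w y : ℝ) + Γ.dist x z ≤
        max ((Γ.dist x y : ℝ) + Γ.dist w z) (Γ.dist y z + Γ.dist w x) + ⌈2 * δ⌉₊ := by
      rcases min_cases (((Γ.dist w x : ℝ) + Γ.dist w y - Γ.dist x y) / 2)
        (((Γ.dist w y : ℝ) + Γ.dist w z - Γ.dist y z) / 2) with ⟨h1, -⟩ | ⟨h1, -⟩
      · have := le_max_left ((Γ.dist x y : ℝ) + Γ.dist w z) (Γ.dist y z + Γ.dist w x)
        linarith
      · have := le_max_right ((Γ.dist x y : ℝ) + Γ.dist w z) (Γ.dist y z + Γ.dist w x)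
        linarith
    exact_mod_cast hr

end WordLength

namespace IsHyperbolicLength

variable {H : Type*} [Group H] {ℓ : H → ℕ} {δ : ℕ}

theorem inv_mul_comm (hℓ : IsHyperbolicLength ℓ δ) (x y : H) : ℓ (x⁻¹ * y) = ℓ (y⁻¹ * x) := by
  rw [← hℓ.inv, mul_inv_rev, inv_inv]

theorem le_conj (hℓ : IsHyperbolicLength ℓ δ) (h x : H) : ℓ (h * x * h⁻¹) ≤ ℓ x + 2 * ℓ h := by
  have h1 := hℓ.mul_le (h * x) h⁻¹
  have h2 := hℓ.mul_le h x
  rw [hℓ.inv] at h1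
  omega

/-! ### Elements with growing powers -/

/-- An element whose square is longer by more than `δ` moves `1` along a uniformly expanding
orbit. -/
theorem length_pow_succ (hℓ : IsHyperbolicLength ℓ δ) {u : H} (hu : ℓ u + δ + 1 ≤ ℓ (u ^ 2))
    (n : ℕ) : ℓ (u ^ n) + 1 ≤ ℓ (u ^ (n + 1)) := by
  induction n with
  | zero =>
    rw [pow_zero, hℓ.one, zero_add, pow_one]
    have : ℓ (u ^ 2) ≤ ℓ u + ℓ u := by rw [pow_two]; exact hℓ.mul_le u u
    omega
  | succ n ih =>
    have h := hℓ.fourPoint 1 (u ^ n) (u ^ (n + 1)) (u ^ (n + 2))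
    rw [show (u ^ n)⁻¹ * u ^ (n + 2) = u ^ 2 by group,
      show (u ^ n)⁻¹ * u ^ (n + 1) = u by group,
      show (u ^ (n + 1))⁻¹ * u ^ (n + 2) = u by group, inv_one, one_mul, one_mul, one_mul] at h
    change ℓ (u ^ (n + 1)) + 1 ≤ ℓ (u ^ (n + 2))
    omega

theorem length_pow_add (hℓ : IsHyperbolicLength ℓ δ) {u : H} (hu : ℓ u + δ + 1 ≤ ℓ (u ^ 2))
    (m n : ℕ) : ℓ (u ^ m) + n ≤ ℓ (u ^ (m + n)) := by
  induction n with
  | zero => simp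
  | succ n ih =>
    have := hℓ.length_pow_succ hu (m + n)
    rw [← add_assoc m n 1]
    omega

/-- A point `p` at distance `t` from `1` on a geodesic from `1` to `q` is nearly on the way from
`1` to every `y` whose Gromov product with `q` is at least `t`. -/
theorem length_inv_mul_le_of_geodesic (hℓ : IsHyperbolicLength ℓ δ) {p q y : H} {t : ℕ}
    (hp : ℓ p = t) (hpq : ℓ (p⁻¹ * q) + t = ℓ q) (hy : 2 * t + ℓ (q⁻¹ * y) ≤ ℓ q + ℓ y) :
    ℓ (p⁻¹ * y) + t ≤ ℓ y + δ := by
  have h := hℓ.fourPoint 1 p q y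
  rw [inv_one, one_mul, one_mul, one_mul] at h
  omega

/-- If no power of `g` satisfies the growth criterion `length_pow_succ`, then a large maximal
displacement of `g, …, g ^ N` is not minimal: it drops when the base point moves towards the
image of `1` that lies farthest away. -/
theorem exists_conj_length_lt (hℓ : IsHyperbolicLength ℓ δ) {g : H} {N D : ℕ}
    (hg : ∀ j, 1 ≤ j → ℓ (g ^ (2 * j)) ≤ ℓ (g ^ j) + δ) (hD : 10 * δ + 4 ≤ D)
    (hle : ∀ j ≤ N, ℓ (g ^ j) ≤ D) {i : ℕ} (hi : i ≤ N) (hiD : ℓ (g ^ i) = D) :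
    ∃ p, ∀ j ≤ N, ℓ (p⁻¹ * g ^ j * p) < D := by
  have hi1 : 1 ≤ i := by
    rcases Nat.eq_zero_or_pos i with rfl | h
    · rw [pow_zero, hℓ.one] at hiD
      omega
    · exact h
  -- Moving the base point by `t` shortens long displacements by `2 * t - 3 * δ`; `t = 2 * δ + 1`
  -- makes this positive, and `10 * δ + 4 = 4 * t + 2 * δ` leaves room for Gromov products `≥ t`.
  obtain ⟨p, hp, hpq⟩ := hℓ.geodesic (g ^ i) (2 * δ + 1) (by omega)
  refine ⟨p, fun j hj => ?_⟩
  have hjD := hle j hj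
  -- Short displacements stay below `D` by the triangle inequality.
  by_cases hlong : ℓ (g ^ j) + 2 * (2 * δ + 1) < D
  · have h := hℓ.le_conj p⁻¹ (g ^ j)
    rw [inv_inv, hℓ.inv] at h
    omega
  have hdiff : ℓ ((g ^ i)⁻¹ * g ^ j) ≤ D := by
    rcases le_total i j with h | h
    · obtain ⟨k, rfl⟩ := Nat.exists_eq_add_of_le h
      rw [show (g ^ i)⁻¹ * g ^ (i + k) = g ^ k by group]
      exact hle k (by omega)
    · obtain ⟨k, rfl⟩ := Nat.exists_eq_add_of_le h
      rw [hℓ.inv_mul_comm, show (g ^ j)⁻¹ * g ^ (j + k) = g ^ k by group]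
      exact hle k (by omega)
  -- Hence `g ^ j` and `(g ^ j)⁻¹` both point in the direction of `g ^ i`, seen from `1`.
  have hpos : ℓ (p⁻¹ * g ^ j) + (2 * δ + 1) ≤ ℓ (g ^ j) + δ :=
    hℓ.length_inv_mul_le_of_geodesic (q := g ^ i) hp (by omega) (by omega)
  have hneg : ℓ (p⁻¹ * (g ^ j)⁻¹) + (2 * δ + 1) ≤ ℓ (g ^ j) + δ := by
    have h4 := hℓ.fourPoint 1 (g ^ i) (g ^ i)⁻¹ (g ^ j)⁻¹
    have h2 := hg i hi1
    rw [inv_one, one_mul, one_mul, one_mul, hℓ.inv, hℓ.inv, inv_inv,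
      show g ^ i * (g ^ j)⁻¹ = (g ^ j)⁻¹ * g ^ i by group, hℓ.inv_mul_comm (g ^ j),
      show (g ^ i)⁻¹ * (g ^ i)⁻¹ = (g ^ (2 * i))⁻¹ by group, hℓ.inv (g ^ (2 * i))] at h4
    have := hℓ.length_inv_mul_le_of_geodesic (q := g ^ i) (y := (g ^ j)⁻¹) hp (by omega)
      (by rw [hℓ.inv (g ^ j)]; omega)
    rwa [hℓ.inv (g ^ j)] at this
  have h4 := hℓ.fourPoint p 1 (g ^ j * p) (g ^ j)
  rw [inv_one, one_mul, one_mul, mul_one, hℓ.inv, mul_inv_rev, mul_assoc, inv_mul_cancel, mul_one,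
    hℓ.inv, ← hℓ.inv (g ^ j * p), mul_inv_rev, ← mul_assoc] at h4
  omega

/-- Discreteness excludes parabolic elements: every element of infinite order has a power with a
conjugate satisfying the growth criterion. -/
theorem exists_conj_pow_growing (hℓ : IsHyperbolicLength ℓ δ) {g : H} (hg : ¬IsOfFinOrder g) :
    ∃ (j : ℕ) (x : H), 1 ≤ j ∧
      ℓ (x⁻¹ * g ^ j * x) + δ + 1 ≤ ℓ ((x⁻¹ * g ^ j * x) ^ 2) := by
  by_contra! hcon
  have hconj : ∀ (x : H) (n : ℕ), (x⁻¹ * g * x) ^ n = x⁻¹ * g ^ n * x := fun x n => by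
    simpa using conj_pow (i := n) (a := x⁻¹) (b := g)
  have hinj := injective_pow_iff_not_isOfFinOrder.2 hg
  set N := (hℓ.finite_ball (10 * δ + 4)).toFinset.card with hN
  have hex : ∃ D, ∃ x, ∀ j ≤ N, ℓ (x⁻¹ * g ^ j * x) ≤ D := by
    refine ⟨(Finset.range (N + 1)).sup fun j => ℓ (1⁻¹ * g ^ j * 1), 1, fun j hj => ?_⟩
    exact Finset.le_sup (f := fun j => ℓ (1⁻¹ * g ^ j * 1)) (Finset.mem_range.2 (by omega))
  classical
  obtain ⟨x, hx⟩ := Nat.find_spec hex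
  set D := Nat.find hex with hDdef
  have hmin : ∀ y D', (∀ j ≤ N, ℓ (y⁻¹ * g ^ j * y) ≤ D') → D ≤ D' :=
    fun y D' h => Nat.find_min' hex ⟨y, h⟩
  have hDle : D ≤ 10 * δ + 4 := by
    by_contra! hlt
    have hi : ∃ i ≤ N, ℓ (x⁻¹ * g ^ i * x) = D := by
      by_contra! hne
      have := hmin x (D - 1) fun j hj => by
        have := hx j hj
        have := hne j hj
        omega
      omega
    obtain ⟨i, hiN, hi⟩ := hi
    obtain ⟨p, hp⟩ := hℓ.exists_conj_length_lt (g := x⁻¹ * g * x) (N := N) (D := D)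
      (fun j hj => by
        have := hcon j x hj
        rw [← hconj, ← pow_mul, mul_comm j 2] at this
        omega)
      (by omega) (fun j hj => by rw [hconj]; exact hx j hj) hiN (by rw [hconj]; exact hi)
    have := hmin (x * p) (D - 1) fun j hj => by
      have := hp j hj
      rw [hconj, show p⁻¹ * (x⁻¹ * g ^ j * x) * p = (x * p)⁻¹ * g ^ j * (x * p) by group] at this
      omega
    omega
  -- The `N + 1` distinct conjugates `x⁻¹ * g ^ j * x` lie in a ball with `N` elements.
  have hcard : (Finset.range (N + 1)).card ≤ N := by
    refine Finset.card_le_card_of_injOn (fun j => x⁻¹ * g ^ j * x) (fun j hj => ?_) ?_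
    · have := hx j (by simpa [Nat.lt_succ_iff] using hj)
      simpa using this.trans hDle
    · intro a _ b _ hab
      exact hinj (by simpa using hab)
  simp at hcard

/-! ### Centralizers -/

/-- Every coset of `⟨u⟩` in the centralizer of `u` meets a fixed ball: a representative `w` of
minimal length spans with `u ^ n` a parallelogram whose diagonals are too long unless `w` is
short. -/
theorem exists_length_mul_zpow_le (hℓ : IsHyperbolicLength ℓ δ) {u : H}
    (hu : ℓ u + δ + 1 ≤ ℓ (u ^ 2)) {z : H} (hz : Commute z u) :
    ∃ k : ℤ, ℓ (z * u ^ k) ≤ ℓ (u ^ (2 * δ + 1)) := by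
  obtain ⟨k, hk⟩ : ∃ k : ℤ, ∀ m : ℤ, ℓ (z * u ^ k) ≤ ℓ (z * u ^ m) :=
    ⟨Function.argmin fun k : ℤ => ℓ (z * u ^ k), fun m =>
      Function.argmin_le (fun k : ℤ => ℓ (z * u ^ k)) m⟩
  refine ⟨k, ?_⟩
  have hw : Commute (z * u ^ k) u := hz.mul_left ((Commute.refl u).zpow_left k)
  have h1 := hk (k + (2 * δ + 1 : ℕ))
  have h2 := hk (k - (2 * δ + 1 : ℕ))
  rw [zpow_add, zpow_natCast, ← mul_assoc] at h1
  rw [zpow_sub, zpow_natCast, ← mul_assoc] at h2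
  generalize z * u ^ k = w at *
  generalize hn : 2 * δ + 1 = n at *
  have hwn : Commute w (u ^ n) := hw.pow_right n
  have hgrow := hℓ.length_pow_add hu n n
  have e1 : ℓ (w⁻¹ * u ^ n) = ℓ (w * (u ^ n)⁻¹) := by
    rw [hℓ.inv_mul_comm, hwn.inv_right.eq]
  have e2 : ℓ (w⁻¹ * (u ^ n)⁻¹) = ℓ (w * u ^ n) := by
    rw [hℓ.inv_mul_comm, inv_inv, hwn.eq]
  have hproj := hℓ.fourPoint w (u ^ n)⁻¹ 1 (u ^ n)
  rw [mul_one, mul_one, hℓ.inv w, inv_inv, inv_one, one_mul, e1, e2, ← pow_add] at hproj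
  have hpar := hℓ.fourPoint 1 (u ^ n) (w * u ^ n) w
  rw [inv_one, one_mul, one_mul, one_mul, hℓ.inv_mul_comm (u ^ n) w, e1, hwn.eq,
    inv_mul_cancel_left, mul_inv_rev, mul_assoc, ← hwn.inv_right.eq, inv_mul_cancel_left,
    hℓ.inv, ← hwn.eq] at hpar
  omega

end IsHyperbolicLength

/-- A torsion-free group with a central cyclic subgroup of finite index `n` is cyclic: the
transfer into that subgroup is `g ↦ g ^ n`, which is injective. -/
theorem isCyclic_of_finiteIndex_zpowers {G : Type*} [Group G]
    (htf : ∀ g : G, IsOfFinOrder g → g = 1) (u : G) (hu : ∀ g, Commute u g)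
    (hfin : (Subgroup.zpowers u).FiniteIndex) : IsCyclic G := by
  have hcen : ∀ h ∈ Subgroup.zpowers u, ∀ g, Commute h g := by
    rintro _ ⟨k, rfl⟩ g
    exact (hu g).zpow_left k
  let _ : CommGroup (Subgroup.zpowers u) :=
    { (inferInstance : Group (Subgroup.zpowers u)) with
      mul_comm := fun a b => Subtype.ext (hcen a a.2 b).eq }
  let τ : G →* Subgroup.zpowers u := MonoidHom.transfer (MonoidHom.id (Subgroup.zpowers u))
  have hτ : ∀ g, (τ g : G) = g ^ (Subgroup.zpowers u).index := fun g => by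
    have := MonoidHom.transfer_eq_pow (MonoidHom.id (Subgroup.zpowers u)) g
      (fun k g₀ hk => by
        simpa [mul_assoc] using (hcen _ hk g₀⁻¹).eq.symm)
    exact congrArg Subtype.val this
  refine isCyclic_of_injective τ ((injective_iff_map_eq_one τ).2 fun g hg => htf g ?_)
  rw [isOfFinOrder_iff_pow_eq_one]
  exact ⟨_, Nat.pos_of_ne_zero hfin.index_ne_zero, by rw [← hτ, hg]; rfl⟩

namespace IsHyperbolicLength

variable {H : Type*} [Group H] {ℓ : H → ℕ} {δ : ℕ}

theorem isCyclic_centralizer_of_growing (hℓ : IsHyperbolicLength ℓ δ)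
    (htf : ∀ h : H, IsOfFinOrder h → h = 1) {u : H} (hu : ℓ u + δ + 1 ≤ ℓ (u ^ 2)) :
    IsCyclic (Subgroup.centralizer {u}) := by
  have hmem : u ∈ Subgroup.centralizer {u} := Subgroup.mem_centralizer_singleton_iff.2 rfl
  refine isCyclic_of_finiteIndex_zpowers (fun g hg => Subtype.ext (htf g ?_)) ⟨u, hmem⟩
    (fun g => Subtype.ext ?_) ?_
  · exact (Subgroup.subtype _).isOfFinOrder hg
  · exact (Subgroup.mem_centralizer_singleton_iff.1 g.2).symm
  · have hball := (hℓ.finite_ball (ℓ (u ^ (2 * δ + 1)))).preimage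
      (Subtype.val_injective (p := (· ∈ Subgroup.centralizer {u})).injOn)
    have : Finite (Subgroup.centralizer {u} ⧸
        Subgroup.zpowers (⟨u, hmem⟩ : Subgroup.centralizer {u})) := by
      refine Set.finite_univ_iff.1 ((hball.image (QuotientGroup.mk)).subset fun q _ => ?_)
      obtain ⟨z, rfl⟩ := QuotientGroup.mk_surjective q
      obtain ⟨k, hk⟩ := hℓ.exists_length_mul_zpow_le hu
        (Subgroup.mem_centralizer_singleton_iff.1 z.2)
      refine ⟨z * ⟨u, hmem⟩ ^ k, by simpa using hk, ?_⟩
      rw [QuotientGroup.mk_mul_of_mem]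
      exact ⟨k, rfl⟩
    exact Subgroup.finiteIndex_of_finite_quotient

theorem isCyclic_centralizer (hℓ : IsHyperbolicLength ℓ δ)
    (htf : ∀ h : H, IsOfFinOrder h → h = 1) {g : H} (hg : g ≠ 1) :
    IsCyclic (Subgroup.centralizer {g}) := by
  obtain ⟨j, x, -, hu⟩ := hℓ.exists_conj_pow_growing fun h => hg (htf g h)
  have := hℓ.isCyclic_centralizer_of_growing htf hu
  let φ : Subgroup.centralizer {g} →* Subgroup.centralizer {x⁻¹ * g ^ j * x} :=
    { toFun := fun z => ⟨x⁻¹ * z * x, by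
        rw [Subgroup.mem_centralizer_singleton_iff]
        have h : Commute (z : H) (g ^ j) :=
          (show Commute (z : H) g from Subgroup.mem_centralizer_singleton_iff.1 z.2).pow_right j
        calc x⁻¹ * z * x * (x⁻¹ * g ^ j * x) = x⁻¹ * (z * g ^ j) * x := by group
          _ = x⁻¹ * (g ^ j * z) * x := by rw [h.eq]
          _ = _ := by group⟩
      map_one' := Subtype.ext (by simp)
      map_mul' := fun a b => Subtype.ext (by simp [mul_assoc]) }
  refine isCyclic_of_injective φ fun a b hab => Subtype.ext ?_
  simpa [φ] using congrArg Subtype.val hab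

/-! ### Conjugate powers -/

/-- The lengths of `u ^ (k * n)` and of its conjugate `u ^ (l * n)` differ by a bounded amount, but
by at least `n` if `|k| ≠ |l|`, for a suitable conjugate `u` of a power of `c`. -/
theorem natAbs_eq_of_conj (hℓ : IsHyperbolicLength ℓ δ) {c h : H} (hc : ¬IsOfFinOrder c)
    {k l : ℤ} (hkl : h * c ^ k * h⁻¹ = c ^ l) : k.natAbs = l.natAbs := by
  have key : ∀ {h : H} {k l : ℤ}, h * c ^ k * h⁻¹ = c ^ l → l.natAbs ≤ k.natAbs := by
    intro h k l hkl
    obtain ⟨j, x, -, hu⟩ := hℓ.exists_conj_pow_growing hc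
    by_contra! hlt
    set u := x⁻¹ * c ^ j * x with hu_def
    have habs : ∀ m : ℤ, ℓ (u ^ m) = ℓ (u ^ m.natAbs) := fun m => by
      rcases Int.natAbs_eq m with h | h
      · conv_lhs => rw [h, zpow_natCast]
      · conv_lhs => rw [h, zpow_neg, zpow_natCast, hℓ.inv]
    have huz : ∀ m : ℤ, u ^ m = x⁻¹ * c ^ (j * m) * x := fun m => by
      rw [hu_def, zpow_mul, zpow_natCast]
      simpa using conj_zpow (i := m) (a := x⁻¹) (b := c ^ j)
    -- `h' = x⁻¹ * h * x` conjugates `u ^ (k * n)` to `u ^ (l * n)`, whose length exceeds that of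
    -- `u ^ (k * n)` by at least `n`.
    set n := 2 * ℓ (x⁻¹ * h * x) + 1 with hn
    have hconj : x⁻¹ * h * x * u ^ (k * n) * (x⁻¹ * h * x)⁻¹ = u ^ (l * n) := by
      have e : h * c ^ ((j : ℤ) * (k * n)) * h⁻¹ = c ^ ((j : ℤ) * (l * n)) := by
        rw [show (j : ℤ) * (k * n) = k * (j * n) by ring,
          show (j : ℤ) * (l * n) = l * (j * n) by ring, zpow_mul, zpow_mul c l, ← conj_zpow, hkl]
      rw [huz, huz, ← e]
      group
    have hle := hℓ.le_conj (x⁻¹ * h * x) (u ^ (k * n))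
    rw [hconj, habs, habs, Int.natAbs_mul, Int.natAbs_mul, Int.natAbs_natCast] at hle
    have hge := hℓ.length_pow_add hu (k.natAbs * n) ((l.natAbs - k.natAbs) * n)
    rw [← add_mul, Nat.add_sub_cancel' hlt.le] at hge
    have : n ≤ (l.natAbs - k.natAbs) * n := Nat.le_mul_of_pos_left n (by omega)
    omega
  refine le_antisymm (key (h := h⁻¹) ?_) (key hkl)
  rw [← hkl]
  group

/-- In a torsion-free hyperbolic group a cyclic subgroup is commensurated only by elements of the
centralizer of its generator. -/
theorem commute_of_conj_zpow (hℓ : IsHyperbolicLength ℓ δ)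
    (htf : ∀ h : H, IsOfFinOrder h → h = 1) {c h : H} (hc : c ≠ 1) {k l : ℤ} (hk : k ≠ 0)
    (hkl : h * c ^ k * h⁻¹ = c ^ l) : Commute h c := by
  have hcinf : ¬IsOfFinOrder c := fun hf => hc (htf c hf)
  -- Two elements commuting with a common nontrivial element commute.
  have htrans : ∀ {a b d : H}, d ≠ 1 → Commute a d → Commute b d → Commute a b := by
    intro a b d hd ha hb
    have := hℓ.isCyclic_centralizer htf hd
    have := @IsCyclic.isMulCommutative _ _ this
    exact congrArg Subtype.val (this.is_comm.comm
      (⟨a, Subgroup.mem_centralizer_singleton_iff.2 ha⟩ : Subgroup.centralizer {d})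
      ⟨b, Subgroup.mem_centralizer_singleton_iff.2 hb⟩)
  have hck : c ^ k ≠ 1 := fun h1 => hcinf (isOfFinOrder_iff_zpow_eq_one.2 ⟨k, hk, h1⟩)
  have hcomm : Commute h (c ^ k) := by
    rcases Int.natAbs_eq_natAbs_iff.1 (hℓ.natAbs_eq_of_conj hcinf hkl) with rfl | rfl
    · exact mul_inv_eq_iff_eq_mul.1 hkl
    · -- If `h` inverts `c ^ k`, then `h ^ 2` commutes with it, and so does `h`, which commutes
      -- with `h ^ 2`.
      by_cases hh : h = 1
      · rw [hh]; exact Commute.one_left _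
      have hh2 : h ^ 2 ≠ 1 := fun h2 =>
        hh (htf h (isOfFinOrder_iff_pow_eq_one.2 ⟨2, by norm_num, h2⟩))
      have h1 : h * c ^ (-l) * h⁻¹ = (c ^ (-l))⁻¹ := by rw [hkl]; simp
      have h2 : h ^ 2 * c ^ (-l) * (h ^ 2)⁻¹ = c ^ (-l) := by
        calc h ^ 2 * c ^ (-l) * (h ^ 2)⁻¹ = h * (h * c ^ (-l) * h⁻¹) * h⁻¹ := by
              rw [pow_two]; group
          _ = (h * c ^ (-l) * h⁻¹)⁻¹ := by rw [conj_inv, h1]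
          _ = c ^ (-l) := by rw [h1, inv_inv]
      have h3 : Commute (h ^ 2) (c ^ (-l)) := mul_inv_eq_iff_eq_mul.1 h2
      exact htrans hh2 ((Commute.refl h).pow_right 2) h3.symm
  exact htrans hck hcomm ((Commute.refl c).zpow_right k)

/-- If conjugation by `h` takes one nontrivial element of the centralizer of `b` into it, then
`h` lies in it. -/
theorem mem_centralizer_of_conj_mem (hℓ : IsHyperbolicLength ℓ δ)
    (htf : ∀ h : H, IsOfFinOrder h → h = 1) {b h z : H} (hb : b ≠ 1) (hz1 : z ≠ 1)
    (hz : z ∈ Subgroup.centralizer {b}) (hw : h * z * h⁻¹ ∈ Subgroup.centralizer {b}) :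
    h ∈ Subgroup.centralizer {b} := by
  have hbb : b ∈ Subgroup.centralizer {b} := Subgroup.mem_centralizer_singleton_iff.2 rfl
  obtain ⟨c, hgen⟩ := (hℓ.isCyclic_centralizer htf hb).exists_generator
  have hpow : ∀ a ∈ Subgroup.centralizer {b}, ∃ m : ℤ, (c : H) ^ m = a := fun a ha => by
    obtain ⟨m, hm⟩ := hgen ⟨a, ha⟩
    exact ⟨m, by simpa using congrArg Subtype.val hm⟩
  obtain ⟨k, rfl⟩ := hpow z hz
  obtain ⟨l, hl⟩ := hpow _ hw
  obtain ⟨m, hm⟩ := hpow b hbb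
  have hc : (c : H) ≠ 1 := fun h => hz1 (by rw [h, one_zpow])
  have hk : k ≠ 0 := by rintro rfl; exact hz1 (zpow_zero _)
  have := (hℓ.commute_of_conj_zpow htf hc hk hl.symm).zpow_right m
  rw [hm] at this
  exact Subgroup.mem_centralizer_singleton_iff.2 this

end IsHyperbolicLength

/-! ### Quasihomomorphisms -/

/-- If `f` is multiplicative up to a finite set and all its values conjugate `b ≠ 1` into a finite
set, then `f` takes finitely many values or commutes with `b`. -/
theorem finite_range_or_range_subset_centralizer {G H : Type*} [Group G] [Group H] {ℓ : H → ℕ}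
    {δ : ℕ} (hℓ : IsHyperbolicLength ℓ δ) (htf : ∀ h : H, IsOfFinOrder h → h = 1) {f : G → H}
    {E F : Set H} (hE : E.Finite) (hF : F.Finite) (hf : ∀ x y, (f x * f y)⁻¹ * f (x * y) ∈ E)
    {b : H} (hb : b ≠ 1) (hconj : ∀ y, (f y)⁻¹ * b * f y ∈ F) :
    (Set.range f).Finite ∨ Set.range f ⊆ Subgroup.centralizer {b} := by
  refine or_iff_not_imp_left.2 fun hinf => ?_
  rintro _ ⟨x, rfl⟩
  choose g hg using fun v : Set.range f => v.2
  have : Infinite (Set.range f) := Set.infinite_coe_iff.2 hinf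
  have := hE.to_subtype
  have := hF.to_subtype
  -- Two of the infinitely many values `f y` have the same conjugate of `b`, the same conjugate by
  -- `f (x * y)` and the same error term for the product `x * y`.
  obtain ⟨v, w, hvw, heq⟩ := Finite.exists_ne_map_eq_of_infinite
    (fun v : Set.range f => ((⟨_, hconj (g v)⟩, ⟨_, hconj (x * g v)⟩, ⟨_, hf x (g v)⟩) : F × F × E))
  simp only [Prod.mk.injEq, Subtype.mk.injEq] at heq
  obtain ⟨h1, h2, h3⟩ := heq
  have hne : f (g v) * (f (g w))⁻¹ ≠ 1 := fun h =>
    hvw (Subtype.ext (by rw [← hg v, ← hg w]; exact mul_inv_eq_one.1 h))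
  have hquot : ∀ {p q : H}, p⁻¹ * b * p = q⁻¹ * b * q → p * q⁻¹ ∈ Subgroup.centralizer {b} := by
    intro p q h
    rw [Subgroup.mem_centralizer_singleton_iff]
    calc p * q⁻¹ * b = p * (q⁻¹ * b * q) * q⁻¹ := by group
      _ = p * (p⁻¹ * b * p) * q⁻¹ := by rw [h]
      _ = b * (p * q⁻¹) := by group
  refine hℓ.mem_centralizer_of_conj_mem htf hb hne (hquot h1) ?_
  have e : f x * (f (g v) * (f (g w))⁻¹) * (f x)⁻¹ = f (x * g v) * (f (x * g w))⁻¹ := by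
    calc f x * (f (g v) * (f (g w))⁻¹) * (f x)⁻¹
        = f x * f (g v) * ((f x * f (g v))⁻¹ * f (x * g v)) *
          ((f x * f (g v))⁻¹ * f (x * g v))⁻¹ * (f x * f (g w))⁻¹ := by group
      _ = f x * f (g v) * ((f x * f (g v))⁻¹ * f (x * g v)) *
          ((f x * f (g w))⁻¹ * f (x * g w))⁻¹ * (f x * f (g w))⁻¹ := by rw [h3]
      _ = _ := by group
  rw [e]
  exact hquot h2

theorem isBounded_iff_finite_of_discrete {X : Type*} [MetricSpace X] [DiscreteTopology X]
    [ProperSpace X] {s : Set X} : Bornology.IsBounded s ↔ s.Finite :=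
  ⟨fun h => h.isCompact_closure.finite_of_discrete.subset subset_closure, Set.Finite.isBounded⟩

theorem exists_finite_forall_inv_mul_mem {ι H : Type*} [Group H] [MetricSpace H]
    [DiscreteTopology H] [ProperSpace H] [IsIsometricSMul H H] {u v : ι → H} {C : ℝ}
    (h : ∀ i, dist (u i) (v i) ≤ C) : ∃ E : Set H, E.Finite ∧ ∀ i, (v i)⁻¹ * u i ∈ E := by
  refine ⟨Metric.closedBall 1 C, (isCompact_closedBall 1 C).finite_of_discrete, fun i => ?_⟩
  rw [Metric.mem_closedBall, ← dist_smul (v i), smul_eq_mul, smul_eq_mul, mul_inv_cancel_left,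
    mul_one]
  exact h i

open scoped Pointwise in
/-- `H` is a discrete group with a proper left-invariant metric. Torsion-freeness is the usual
condition that `1` is the only element of finite order. -/
theorem mainTheorem8 {G H : Type*} [Group G] [Group H]
    [MetricSpace H] [DiscreteTopology H] [ProperSpace H] [IsIsometricSMul H H]
    (hH : IsHyperbolicGroup H) (htf : ∀ h : H, IsOfFinOrder h → h = 1)
    (f₁ f₂ : G → H) (hf₁ : IsQuasihomomorphism f₁) (hf₂ : IsQuasihomomorphism f₂)
    (hdist : supDist f₁ f₂ < ⊤) :
    (Bornology.IsBounded (Set.range f₁) ∧ Bornology.IsBounded (Set.range f₂)) ∨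
    (∃ C : Subgroup H, IsCyclic C ∧ Set.range f₁ ⊆ C ∧ Set.range f₂ ⊆ C) ∨
    f₁ = f₂ := by
  obtain ⟨ℓ, δ, hℓ⟩ := hH.exists_isHyperbolicLength
  obtain ⟨C₁, hC₁⟩ := hf₁
  obtain ⟨C₂, hC₂⟩ := hf₂
  obtain ⟨E₁, hE₁, hfE₁⟩ := exists_finite_forall_inv_mul_mem
    (u := fun p : G × G => f₁ (p.1 * p.2)) (v := fun p => f₁ p.1 * f₁ p.2) fun p => hC₁ p.1 p.2
  obtain ⟨E₂, hE₂, hfE₂⟩ := exists_finite_forall_inv_mul_mem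
    (u := fun p : G × G => f₂ (p.1 * p.2)) (v := fun p => f₂ p.1 * f₂ p.2) fun p => hC₂ p.1 p.2
  obtain ⟨B, hB, hfB⟩ := exists_finite_forall_inv_mul_mem (u := f₁) (v := f₂)
    (C := (supDist f₁ f₂).toReal) fun x => by
      rw [dist_edist]
      exact ENNReal.toReal_mono hdist.ne (le_iSup (fun x => edist (f₁ x) (f₂ x)) x)
  by_cases heq : f₁ = f₂
  · exact Or.inr (Or.inr heq)
  obtain ⟨x, hx⟩ := Function.ne_iff.1 heq
  obtain ⟨b, hbdef⟩ : ∃ b, b = (f₂ x)⁻¹ * f₁ x := ⟨_, rfl⟩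
  have hb : b ≠ 1 := fun h => hx (inv_mul_eq_one.1 (hbdef.symm.trans h)).symm
  -- Expanding `f₁ (x * y)` through `f₁ = f₂ * (bounded)` in two ways expresses the conjugate of
  -- `b` by `f₂ y` through bounded terms.
  have hconj₂ : ∀ y, (f₂ y)⁻¹ * b * f₂ y ∈ E₂ * B * E₁⁻¹ * B⁻¹ := fun y => by
    have e : (f₂ y)⁻¹ * b * f₂ y = ((f₂ x * f₂ y)⁻¹ * f₂ (x * y)) *
        ((f₂ (x * y))⁻¹ * f₁ (x * y)) * ((f₁ x * f₁ y)⁻¹ * f₁ (x * y))⁻¹ *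
        ((f₂ y)⁻¹ * f₁ y)⁻¹ := by
      rw [hbdef]
      group
    rw [e]
    exact Set.mul_mem_mul (Set.mul_mem_mul (Set.mul_mem_mul (hfE₂ (x, y)) (hfB _))
      (Set.inv_mem_inv.2 (hfE₁ (x, y)))) (Set.inv_mem_inv.2 (hfB y))
  have hconj₁ : ∀ y, (f₁ y)⁻¹ * b * f₁ y ∈ B⁻¹ * (E₂ * B * E₁⁻¹ * B⁻¹) * B := fun y => by
    have e : (f₁ y)⁻¹ * b * f₁ y =
        ((f₂ y)⁻¹ * f₁ y)⁻¹ * ((f₂ y)⁻¹ * b * f₂ y) * ((f₂ y)⁻¹ * f₁ y) := by group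
    rw [e]
    exact Set.mul_mem_mul (Set.mul_mem_mul (Set.inv_mem_inv.2 (hfB y)) (hconj₂ y)) (hfB y)
  have hF := ((hE₂.mul hB).mul hE₁.inv).mul hB.inv
  have h₁ := finite_range_or_range_subset_centralizer hℓ htf hE₁ ((hB.inv.mul hF).mul hB)
    (fun x y => hfE₁ (x, y)) hb hconj₁
  have h₂ := finite_range_or_range_subset_centralizer hℓ htf hE₂ hF
    (fun x y => hfE₂ (x, y)) hb hconj₂
  rw [isBounded_iff_finite_of_discrete, isBounded_iff_finite_of_discrete]
  have h12 : (Set.range f₁).Finite → (Set.range f₂).Finite := fun h => by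
    refine (h.mul hB.inv).subset ?_
    rintro _ ⟨y, rfl⟩
    exact ⟨f₁ y, ⟨y, rfl⟩, _, Set.inv_mem_inv.2 (hfB y), by group⟩
  have h21 : (Set.range f₂).Finite → (Set.range f₁).Finite := fun h => by
    refine (h.mul hB).subset ?_
    rintro _ ⟨y, rfl⟩
    exact ⟨f₂ y, ⟨y, rfl⟩, _, hfB y, by group⟩
  rcases h₁ with h₁ | h₁
  · exact Or.inl ⟨h₁, h12 h₁⟩
  rcases h₂ with h₂ | h₂
  · exact Or.inl ⟨h21 h₂, h₂⟩
  · exact Or.inr (Or.inl ⟨_, hℓ.isCyclic_centralizer htf hb, h₁, h₂⟩)
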